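/- Let $a\in\mathbb C$ with $|a|<1$, let $B(z)=\left(\dfrac{z+a}{1+\bar a z}\right)^2$, let $B_n$ denote the $n$-th iterate of $B$, and put $Q=27|a|^4-18|a|^2+8\operatorname{Re}a$. Write $\mathbb D$ for the open unit disk and $\mathbb T$ for the unit circle. A fixed point $p$ of $B$ is called attracting if $|B'(p)|<1$ and non-repelling if $|B'(p)|\le 1$; its multiplicity is the order of vanishing of $B(z)-z$ at $p$. 1. If $Q<1$, then $B$ has exactly one fixed point $\alpha$ in $\mathbb D$ and exactly one fixed point in $\mathbb T$. The point $\alpha$ is attracting, the fixed point in $\mathbb T$ is not, and $B_n\to\alpha$ uniformly on every compact subset of $\mathbb D$. 2. If $Q\ge 1$, then $B$ has no fixed point in $\mathbb D$ and it has three fixed points in $\mathbb T$, counted with multiplicity; they are distinct if $Q>1$. Exactly one fixed point $p\in\mathbb T$ is non-repelling; it is attracting if $Q>1$, whereas $|B'(p)|=1$ if $Q=1$. Moreover $B_n\to p$ uniformly on every compact subset of $\mathbb D$. -/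

import Mathlib

open Complex Metric Filter Function

noncomputable section

/-- The Blaschke product `z ↦ ((z + a) / (1 + ā z)) ^ 2`. -/
def blaschkeSq (a z : ℂ) : ℂ :=
  ((z + a) / (1 + (starRingEnd ℂ) a * z)) ^ 2

/-- The quantity `27 |a|⁴ - 18 |a|² + 8 Re a`. -/
def cardioidValue (a : ℂ) : ℝ :=
  27 * ‖a‖ ^ 4 - 18 * ‖a‖ ^ 2 + 8 * a.re

/-- An attracting fixed point: a fixed point whose multiplier has modulus less than one. -/
def IsAttractingFixedPt (f : ℂ → ℂ) (p : ℂ) : Prop :=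
  DifferentiableAt ℂ f p ∧ IsFixedPt f p ∧ ‖deriv f p‖ < 1

/-- A non-repelling fixed point: a fixed point whose multiplier has modulus at most one. -/
def IsNonrepellingFixedPt (f : ℂ → ℂ) (p : ℂ) : Prop :=
  DifferentiableAt ℂ f p ∧ IsFixedPt f p ∧ ‖deriv f p‖ ≤ 1

/-- The multiplicity of `p` as a fixed point of `f`: the order of vanishing of `f z - z` at `p`
(zero if `f` is analytic at `p` and `p` is not a fixed point). -/
def fixedPtMultiplicity (f : ℂ → ℂ) (p : ℂ) : ℕ :=
  analyticOrderNatAt (fun z => f z - z) p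

/-- The iterates of `f` converge to the constant `p`, uniformly on every compact subset of the
open unit disk. -/
def IteratesTendstoOnDisk (f : ℂ → ℂ) (p : ℂ) : Prop :=
  ∀ K : Set ℂ, IsCompact K → K ⊆ ball (0 : ℂ) 1 →
    TendstoUniformlyOn (fun n : ℕ => f^[n]) (fun _ => p) atTop K

end

/-!
The map `B = blaschkeSq a` is the square of the disk automorphism `φ = blaschkeFactor a`. The
squared norms of `q - w` and `q + w` add up to `2 + 2 ‖w‖ ^ 2` for `q` on the unit circle, so the
Poisson kernel `P` of the disk at a boundary fixed point `p` satisfies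
`‖B'(p)‖ P(B z) = P(z) (1 + ‖φ p - φ z‖ ^ 2 / ‖φ p + φ z‖ ^ 2)`. If `p` is non-repelling, `P`
therefore increases along orbits, which forces them to converge to `p`; if `B` fixes a point of the
disk, evaluating there shows that `p` is repelling. For an interior fixed point, convergence holds
because its basin is open and, the iterates being bounded and hence equicontinuous, relatively
closed.

The fixed points are the roots of a cubic with discriminant
`(1 - ‖a‖ ^ 2) ^ 2 * (1 - cardioidValue a)`, whose root set is symmetric in the unit circle. Without
an interior fixed point all roots lie on the circle, and then the discriminant is at most zero. The
multipliers there are positive: a double root has multiplier `1`, and for distinct roots the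
holomorphic fixed-point formula `∑ 1 / (1 - B'(p)) = 1` prevents all three from being repelling. An
interior fixed point has the form `v ^ 2` with `v = φ (v ^ 2)`. This expresses `a` through `v` and
its conjugate, which makes `1 - cardioidValue a` visibly positive and splits the cubic explicitly.
-/

open scoped ComplexConjugate Topology

section Iteration

lemma equicontinuousAt_of_differentiableOn_of_mapsTo {ι E : Type*} [NormedAddCommGroup E]
    [NormedSpace ℂ E] {F : ι → ℂ → E} {Ω : Set ℂ} {S : Set E} {z : ℂ} (hΩ : Ω ∈ 𝓝 z)
    (hF : ∀ i, DifferentiableOn ℂ (F i) Ω) (hS : Bornology.IsBounded S)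
    (hmaps : ∀ i, Set.MapsTo (F i) Ω S) : EquicontinuousAt F z := by
  obtain ⟨R, hR, hball⟩ := Metric.mem_nhds_iff.1 hΩ
  refine equicontinuousAt_of_continuity_modulus (fun w => diam S / R * dist w z) ?_ F ?_
  · exact Continuous.tendsto' (by fun_prop) _ _ (by simp)
  · filter_upwards [ball_mem_nhds z hR] with w hw i
    rw [dist_comm]
    refine dist_le_div_mul_dist_of_mapsTo_ball ((hF i).mono hball) (fun u hu => ?_) hw
    exact dist_le_diam_of_mem hS (hmaps i (hball hu)) (hmaps i (mem_of_mem_nhds hΩ))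

lemma equicontinuousAt_iterate {f : ℂ → ℂ} {Ω : Set ℂ} (hΩ : IsOpen Ω)
    (hb : Bornology.IsBounded Ω) (hf : DifferentiableOn ℂ f Ω) (hmaps : Set.MapsTo f Ω Ω) {z : ℂ}
    (hz : z ∈ Ω) : EquicontinuousAt (fun n : ℕ => f^[n]) z :=
  equicontinuousAt_of_differentiableOn_of_mapsTo (hΩ.mem_nhds hz)
    (hf.iterate hmaps) hb fun n => hmaps.iterate n

lemma tendstoUniformlyOn_of_equicontinuousOn {ι X α : Type*} [TopologicalSpace X] [UniformSpace α]
    {F : ι → X → α} {f : X → α} {l : Filter ι} {K : Set X} (hK : IsCompact K)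
    (hF : EquicontinuousOn F K) (hlim : ∀ x ∈ K, Tendsto (F · x) l (𝓝 (f x))) :
    TendstoUniformlyOn F f l K := by
  have h := (EquicontinuousOn.tendsto_uniformOnFun_iff_pi' (𝔖 := {K}) (F := F) (f := f) (ℱ := l)
    (by simpa using hK) (by simpa using hF)).2
      (tendsto_pi_nhds.2 fun x => hlim x (by simpa using x.2))
  exact (UniformOnFun.tendsto_iff_tendstoUniformlyOn.1 h) K rfl

lemma iteratesTendstoOnDisk_of_tendsto {f : ℂ → ℂ} {p : ℂ}
    (hf : DifferentiableOn ℂ f (ball 0 1)) (hmaps : Set.MapsTo f (ball 0 1) (ball 0 1))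
    (hlim : ∀ z ∈ ball (0 : ℂ) 1, Tendsto (fun n => f^[n] z) atTop (𝓝 p)) :
    IteratesTendstoOnDisk f p := fun K hK hKball =>
  tendstoUniformlyOn_of_equicontinuousOn hK
    (fun _ hz => (equicontinuousAt_iterate isOpen_ball isBounded_ball hf hmaps
      (hKball hz)).equicontinuousWithinAt K)
    fun _ hz => hlim _ (hKball hz)

lemma eventually_tendsto_iterate {𝕜 : Type*} [NontriviallyNormedField 𝕜] {f : 𝕜 → 𝕜} {f' α : 𝕜}
    (hf : HasDerivAt f f' α) (hfix : IsFixedPt f α) (hf' : ‖f'‖ < 1) :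
    ∀ᶠ z in 𝓝 α, Tendsto (fun n => f^[n] z) atTop (𝓝 α) := by
  obtain ⟨c, hc, hc1⟩ := exists_between hf'
  have hlip : ∀ᶠ z in 𝓝 α, dist (f z) α ≤ c * dist z α := by
    filter_upwards [hf.isLittleO.def (sub_pos.2 hc)] with z hz
    have h := norm_le_norm_add_norm_sub' (f z - f α) ((z - α) • f')
    rw [hfix.eq, norm_smul] at *
    rw [dist_eq_norm, dist_eq_norm]
    linarith
  obtain ⟨R, hR, hball⟩ := Metric.eventually_nhds_iff_ball.1 hlip
  filter_upwards [ball_mem_nhds α hR] with z hz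
  have hc0 : 0 ≤ c := (norm_nonneg f').trans hc.le
  have hgeom (n : ℕ) : dist (f^[n] z) α ≤ c ^ n * dist z α := by
    induction n with
    | zero => simp
    | succ n ih =>
      have hmem : f^[n] z ∈ ball α R :=
        (ih.trans (mul_le_of_le_one_left dist_nonneg (pow_le_one₀ hc0 hc1.le))).trans_lt hz
      rw [iterate_succ_apply', pow_succ', mul_assoc]
      exact (hball _ hmem).trans (mul_le_mul_of_nonneg_left ih hc0)
  refine squeeze_zero (fun _ => dist_nonneg) hgeom ?_ |> tendsto_iff_dist_tendsto_zero.2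
  simpa using (tendsto_pow_atTop_nhds_zero_of_lt_one hc0 hc1).mul_const (dist z α)

lemma tendsto_iterate_of_isAttractingFixedPt {f : ℂ → ℂ} {Ω : Set ℂ} (hΩ : IsOpen Ω)
    (hb : Bornology.IsBounded Ω) (hconn : IsPreconnected Ω) (hf : DifferentiableOn ℂ f Ω)
    (hmaps : Set.MapsTo f Ω Ω) {α : ℂ} (hα : α ∈ Ω) (hatt : IsAttractingFixedPt f α) {z : ℂ}
    (hz : z ∈ Ω) : Tendsto (fun n => f^[n] z) atTop (𝓝 α) := by
  let basin : Set ℂ := {z | Tendsto (fun n => f^[n] z) atTop (𝓝 α)}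
  have hnear : basin ∈ 𝓝 α := eventually_tendsto_iterate hatt.1.hasDerivAt hatt.2.1 hatt.2.2
  have hopen : IsOpen (Ω ∩ basin) := by
    rw [isOpen_iff_mem_nhds]
    rintro w ⟨hwΩ, hw⟩
    obtain ⟨n, hn⟩ := (hw.eventually (eventually_mem_nhds_iff.2 hnear)).exists
    have hcont := ((hf.iterate hmaps n).continuousOn.continuousAt
      (hΩ.mem_nhds hwΩ)).preimage_mem_nhds hn
    filter_upwards [hΩ.mem_nhds hwΩ, hcont] with u huΩ hu
    refine ⟨huΩ, (tendsto_add_atTop_iff_nat n).1 ?_⟩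
    exact Tendsto.congr (fun k => (iterate_add_apply f k n u).symm) hu
  -- Equicontinuity makes the basin relatively closed.
  have hclosed : closure (Ω ∩ basin) ∩ Ω ⊆ Ω ∩ basin := fun w ⟨hw, hwΩ⟩ =>
    ⟨hwΩ, (equicontinuousAt_iterate hΩ hb hf hmaps hwΩ).tendsto_of_mem_closure
      (f := fun _ => α) tendsto_const_nhds (fun u hu => hu.2) hw⟩
  exact (hconn.subset_of_closure_inter_subset hopen
    ⟨α, hα, hα, mem_of_mem_nhds hnear⟩ hclosed hz).2

end Iteration

/-- The disk automorphism `z ↦ (z + a) / (1 + ā z)`, of which `blaschkeSq a` is the square. -/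
noncomputable def blaschkeFactor (a z : ℂ) : ℂ :=
  (z + a) / (1 + conj a * z)

section BlaschkeFactor

variable {a z w : ℂ}

lemma blaschkeSq_eq_sq (a z : ℂ) : blaschkeSq a z = blaschkeFactor a z ^ 2 := rfl

lemma one_sub_norm_sq_pos (ha : ‖a‖ < 1) : 0 < 1 - ‖a‖ ^ 2 :=
  sub_pos.2 (pow_lt_one₀ (norm_nonneg a) ha two_ne_zero)

lemma one_add_conj_mul_ne_zero (ha : ‖a‖ < 1) (hz : ‖z‖ ≤ 1) : 1 + conj a * z ≠ 0 := by
  intro h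
  have hnorm : ‖conj a * z‖ = 1 := by
    rw [eq_neg_of_add_eq_zero_right h, norm_neg, norm_one]
  rw [norm_mul, RCLike.norm_conj] at hnorm
  exact (mul_lt_one_of_nonneg_of_lt_one_left (norm_nonneg a) ha hz).ne hnorm

lemma one_sub_norm_sq_blaschkeFactor (hz : 1 + conj a * z ≠ 0) :
    1 - ‖blaschkeFactor a z‖ ^ 2 =
      (1 - ‖a‖ ^ 2) * (1 - ‖z‖ ^ 2) / ‖1 + conj a * z‖ ^ 2 := by
  have hz' : ‖1 + conj a * z‖ ≠ 0 := norm_ne_zero_iff.2 hz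
  rw [blaschkeFactor, norm_div, div_pow, eq_div_iff (pow_ne_zero 2 hz'), sub_mul,
    div_mul_cancel₀ _ (pow_ne_zero 2 hz'), one_mul]
  simp only [← normSq_eq_norm_sq, normSq_apply, add_re, add_im, mul_re, mul_im, conj_re, conj_im,
    one_re, one_im]
  ring

lemma norm_blaschkeFactor_lt_one (ha : ‖a‖ < 1) (hz : ‖z‖ < 1) : ‖blaschkeFactor a z‖ < 1 := by
  have hd := one_add_conj_mul_ne_zero ha hz.le
  have h : 0 < 1 - ‖blaschkeFactor a z‖ ^ 2 := by
    rw [one_sub_norm_sq_blaschkeFactor hd]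
    have := one_sub_norm_sq_pos ha
    have := one_sub_norm_sq_pos hz
    positivity
  exact (sq_lt_one_iff₀ (norm_nonneg _)).1 (sub_pos.1 h)

lemma norm_blaschkeFactor_eq_one (ha : ‖a‖ < 1) (hz : ‖z‖ = 1) : ‖blaschkeFactor a z‖ = 1 := by
  have h := one_sub_norm_sq_blaschkeFactor (one_add_conj_mul_ne_zero ha hz.le)
  rw [hz, one_pow, sub_self, mul_zero, zero_div, sub_eq_zero] at h
  exact (pow_eq_one_iff_of_nonneg (norm_nonneg _) two_ne_zero).1 h.symm

lemma blaschkeFactor_sub (hz : 1 + conj a * z ≠ 0) (hw : 1 + conj a * w ≠ 0) :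
    blaschkeFactor a z - blaschkeFactor a w =
      (1 - ‖a‖ ^ 2 : ℝ) * (z - w) / ((1 + conj a * z) * (1 + conj a * w)) := by
  rw [blaschkeFactor, blaschkeFactor, div_sub_div _ _ hz hw]
  push_cast
  rw [← conj_mul']
  ring

lemma mapsTo_blaschkeSq_ball (ha : ‖a‖ < 1) :
    Set.MapsTo (blaschkeSq a) (ball 0 1) (ball 0 1) := by
  intro z hz
  rw [mem_ball_zero_iff] at hz ⊢
  rw [blaschkeSq_eq_sq, norm_pow]
  exact pow_lt_one₀ (norm_nonneg _) (norm_blaschkeFactor_lt_one ha hz) two_ne_zero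

lemma hasDerivAt_blaschkeSq (hz : 1 + conj a * z ≠ 0) :
    HasDerivAt (blaschkeSq a)
      (2 * blaschkeFactor a z * (1 - ‖a‖ ^ 2 : ℝ) / (1 + conj a * z) ^ 2) z := by
  have hnum : HasDerivAt (fun z : ℂ => z + a) 1 z := (hasDerivAt_id z).add_const a
  have hden : HasDerivAt (fun z : ℂ => 1 + conj a * z) (conj a) z := by
    simpa using ((hasDerivAt_id z).const_mul (conj a)).const_add 1
  refine ((hnum.div hden hz).pow 2).congr_deriv ?_
  push_cast
  rw [← conj_mul', blaschkeFactor]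
  simp only [Pi.div_apply, pow_one, mul_div_assoc]
  ring

lemma differentiableOn_blaschkeSq (ha : ‖a‖ < 1) :
    DifferentiableOn ℂ (blaschkeSq a) (ball 0 1) := fun _ hz =>
  (hasDerivAt_blaschkeSq (one_add_conj_mul_ne_zero ha
    (mem_ball_zero_iff.1 hz).le)).differentiableAt.differentiableWithinAt

lemma norm_deriv_blaschkeSq (ha : ‖a‖ < 1) (hz : ‖z‖ ≤ 1) :
    ‖deriv (blaschkeSq a) z‖ =
      2 * ‖blaschkeFactor a z‖ * (1 - ‖a‖ ^ 2) / ‖1 + conj a * z‖ ^ 2 := by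
  rw [(hasDerivAt_blaschkeSq (one_add_conj_mul_ne_zero ha hz)).deriv, norm_div, norm_mul, norm_mul,
    norm_pow, norm_real, Real.norm_of_nonneg (one_sub_norm_sq_pos ha).le, RCLike.norm_ofNat]

lemma isAttractingFixedPt_of_mem_ball (ha : ‖a‖ < 1) (hz : ‖z‖ < 1)
    (hfix : IsFixedPt (blaschkeSq a) z) : IsAttractingFixedPt (blaschkeSq a) z := by
  have hd := one_add_conj_mul_ne_zero ha hz.le
  have hd' : ‖1 + conj a * z‖ ≠ 0 := norm_ne_zero_iff.2 hd
  refine ⟨(hasDerivAt_blaschkeSq hd).differentiableAt, hfix, ?_⟩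
  set r := ‖blaschkeFactor a z‖ with hr
  have hr1 : r < 1 := norm_blaschkeFactor_lt_one ha hz
  have hzr : ‖z‖ = r ^ 2 := by rw [hr, ← norm_pow, ← blaschkeSq_eq_sq, hfix.eq]
  have hpick := one_sub_norm_sq_blaschkeFactor hd
  rw [← hr, hzr, eq_div_iff (pow_ne_zero 2 hd')] at hpick
  have hpos := one_sub_norm_sq_pos hr1
  -- `1 - r ^ 4 = (1 - r ^ 2) * (1 + r ^ 2)`, so the multiplier has modulus `2 r / (1 + r ^ 2)`.
  have hden : ‖1 + conj a * z‖ ^ 2 = (1 - ‖a‖ ^ 2) * (1 + r ^ 2) :=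
    mul_left_cancel₀ hpos.ne' (by linear_combination hpick)
  have ha' := one_sub_norm_sq_pos ha
  rw [norm_deriv_blaschkeSq ha hz.le, ← hr, hden, div_lt_one (by positivity)]
  nlinarith [mul_pos ha' (pow_pos (sub_pos.2 hr1) 2)]

lemma tendsto_iterate_of_isFixedPt_ball (ha : ‖a‖ < 1) (hw : ‖w‖ < 1)
    (hfix : IsFixedPt (blaschkeSq a) w) (hz : ‖z‖ < 1) :
    Tendsto (fun n => (blaschkeSq a)^[n] z) atTop (𝓝 w) :=
  tendsto_iterate_of_isAttractingFixedPt isOpen_ball isBounded_ball (convex_ball 0 1).isPreconnected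
    (differentiableOn_blaschkeSq ha) (mapsTo_blaschkeSq_ball ha) (mem_ball_zero_iff.2 hw)
    (isAttractingFixedPt_of_mem_ball ha hw hfix) (mem_ball_zero_iff.2 hz)

lemma iteratesTendstoOnDisk_of_isFixedPt_ball (ha : ‖a‖ < 1) (hz : ‖z‖ < 1)
    (hfix : IsFixedPt (blaschkeSq a) z) : IteratesTendstoOnDisk (blaschkeSq a) z :=
  iteratesTendstoOnDisk_of_tendsto (differentiableOn_blaschkeSq ha) (mapsTo_blaschkeSq_ball ha)
    fun _ hw => tendsto_iterate_of_isFixedPt_ball ha hz hfix (mem_ball_zero_iff.1 hw)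

lemma isFixedPt_ball_iff_eq (ha : ‖a‖ < 1) (hz : ‖z‖ < 1) (hfix : IsFixedPt (blaschkeSq a) z)
    (hw : ‖w‖ < 1) : IsFixedPt (blaschkeSq a) w ↔ w = z :=
  ⟨fun h => tendsto_nhds_unique tendsto_const_nhds
    ((tendsto_iterate_of_isFixedPt_ball ha hz hfix hw).congr fun n => h.iterate n),
    fun h => h ▸ hfix⟩

end BlaschkeFactor

section Julia

variable {a p q z w : ℂ}

lemma tendsto_of_tendsto_norm_sub_sq {ι E : Type*} [SeminormedAddCommGroup E] {l : Filter ι}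
    {u : ι → E} {c : E} (h : Tendsto (fun i => ‖c - u i‖ ^ 2) l (𝓝 0)) : Tendsto u l (𝓝 c) := by
  rw [tendsto_iff_norm_sub_tendsto_zero]
  simpa only [Real.sqrt_zero, Real.sqrt_sq (norm_nonneg _), norm_sub_rev] using h.sqrt

lemma poissonKernel_zero_of_norm_eq_one (hp : ‖p‖ = 1) (z : ℂ) :
    poissonKernel 0 z p = (1 - ‖z‖ ^ 2) / ‖p - z‖ ^ 2 := by
  simp only [poissonKernel_def, sub_zero, hp, one_pow]

lemma norm_sub_pos_of_norm_lt_one (hp : ‖p‖ = 1) (hz : ‖z‖ < 1) : 0 < ‖p - z‖ :=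
  norm_sub_pos_iff.2 fun h => hz.ne (h ▸ hp)

lemma norm_add_pos_of_norm_lt_one (hp : ‖p‖ = 1) (hz : ‖z‖ < 1) : 0 < ‖p + z‖ := by
  simpa only [sub_neg_eq_add] using norm_sub_pos_of_norm_lt_one hp ((norm_neg z).trans_lt hz)

lemma poissonKernel_pos (hp : ‖p‖ = 1) (hz : ‖z‖ < 1) : 0 < poissonKernel 0 z p := by
  rw [poissonKernel_zero_of_norm_eq_one hp]
  exact div_pos (one_sub_norm_sq_pos hz) (pow_pos (norm_sub_pos_of_norm_lt_one hp hz) 2)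

lemma poissonKernel_blaschkeFactor (ha : ‖a‖ < 1) (hp : ‖p‖ = 1) (hz : ‖z‖ < 1) :
    poissonKernel 0 (blaschkeFactor a z) (blaschkeFactor a p) =
      ‖1 + conj a * p‖ ^ 2 / (1 - ‖a‖ ^ 2) * poissonKernel 0 z p := by
  have hdp := one_add_conj_mul_ne_zero ha hp.le
  have hdz := one_add_conj_mul_ne_zero ha hz.le
  have ha' := one_sub_norm_sq_pos ha
  have hdp' : ‖1 + conj a * p‖ ≠ 0 := norm_ne_zero_iff.2 hdp
  have hdz' : ‖1 + conj a * z‖ ≠ 0 := norm_ne_zero_iff.2 hdz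
  have hpz := (norm_sub_pos_of_norm_lt_one hp hz).ne'
  rw [poissonKernel_zero_of_norm_eq_one (norm_blaschkeFactor_eq_one ha hp),
    poissonKernel_zero_of_norm_eq_one hp, one_sub_norm_sq_blaschkeFactor hdz,
    blaschkeFactor_sub hdp hdz, norm_div, norm_mul, norm_mul, norm_real,
    Real.norm_of_nonneg ha'.le]
  have := ha'.ne'
  field_simp

lemma poissonKernel_sq (hq : ‖q‖ = 1) (hw : ‖w‖ < 1) :
    2 * poissonKernel 0 (w ^ 2) (q ^ 2) =
      poissonKernel 0 w q * (1 + ‖q - w‖ ^ 2 / ‖q + w‖ ^ 2) := by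
  have hsub := (norm_sub_pos_of_norm_lt_one hq hw).ne'
  have hadd := (norm_add_pos_of_norm_lt_one hq hw).ne'
  have hpar := parallelogram_law_with_norm ℝ q w
  rw [hq] at hpar
  rw [poissonKernel_zero_of_norm_eq_one hq,
    poissonKernel_zero_of_norm_eq_one (by rw [norm_pow, hq, one_pow]), sq_sub_sq, norm_mul,
    norm_pow]
  field_simp
  linear_combination (1 - ‖w‖ ^ 2) * -hpar

lemma norm_deriv_mul_poissonKernel_blaschkeSq (ha : ‖a‖ < 1) (hp : ‖p‖ = 1)
    (hfix : IsFixedPt (blaschkeSq a) p) (hz : ‖z‖ < 1) :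
    ‖deriv (blaschkeSq a) p‖ * poissonKernel 0 (blaschkeSq a z) p =
      poissonKernel 0 z p * (1 + ‖blaschkeFactor a p - blaschkeFactor a z‖ ^ 2 /
        ‖blaschkeFactor a p + blaschkeFactor a z‖ ^ 2) := by
  have hq := norm_blaschkeFactor_eq_one ha hp
  have hdp : ‖1 + conj a * p‖ ≠ 0 := norm_ne_zero_iff.2 (one_add_conj_mul_ne_zero ha hp.le)
  have ha' := (one_sub_norm_sq_pos ha).ne'
  have hsq := poissonKernel_sq hq (norm_blaschkeFactor_lt_one ha hz)
  rw [poissonKernel_blaschkeFactor ha hp hz, ← blaschkeSq_eq_sq, ← blaschkeSq_eq_sq, hfix.eq]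
    at hsq
  rw [norm_deriv_blaschkeSq ha hp.le, hq, mul_one, mul_div_assoc, mul_right_comm, hsq]
  field_simp

lemma one_lt_norm_deriv_of_isFixedPt_ball (ha : ‖a‖ < 1) (hp : ‖p‖ = 1)
    (hfix : IsFixedPt (blaschkeSq a) p) (hz : ‖z‖ < 1) (hz' : IsFixedPt (blaschkeSq a) z) :
    1 < ‖deriv (blaschkeSq a) p‖ := by
  have hjulia := norm_deriv_mul_poissonKernel_blaschkeSq ha hp hfix hz
  have hP := poissonKernel_pos hp hz
  rw [hz'.eq, mul_comm] at hjulia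
  have hq := norm_blaschkeFactor_eq_one ha hp
  have hw := norm_blaschkeFactor_lt_one ha hz
  have hsub := norm_sub_pos_of_norm_lt_one hq hw
  have hadd := norm_add_pos_of_norm_lt_one hq hw
  rw [mul_left_cancel₀ hP.ne' hjulia]
  exact lt_add_of_pos_right _ (by positivity)

lemma poissonKernel_mul_le_poissonKernel_blaschkeSq (ha : ‖a‖ < 1) (hp : ‖p‖ = 1)
    (hfix : IsFixedPt (blaschkeSq a) p) (hp' : ‖deriv (blaschkeSq a) p‖ ≤ 1) (hz : ‖z‖ < 1) :
    poissonKernel 0 z p * (1 + ‖blaschkeFactor a p - blaschkeFactor a z‖ ^ 2 / 4) ≤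
      poissonKernel 0 (blaschkeSq a z) p := by
  have hq := norm_blaschkeFactor_eq_one ha hp
  have hw := norm_blaschkeFactor_lt_one ha hz
  have hadd := norm_add_pos_of_norm_lt_one hq hw
  have hadd2 : ‖blaschkeFactor a p + blaschkeFactor a z‖ ^ 2 ≤ 4 := by
    have := norm_add_le (blaschkeFactor a p) (blaschkeFactor a z)
    nlinarith
  have hBz := poissonKernel_pos hp (mem_ball_zero_iff.1
    (mapsTo_blaschkeSq_ball ha (mem_ball_zero_iff.2 hz)))
  calc poissonKernel 0 z p * (1 + ‖blaschkeFactor a p - blaschkeFactor a z‖ ^ 2 / 4)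
      ≤ poissonKernel 0 z p * (1 + ‖blaschkeFactor a p - blaschkeFactor a z‖ ^ 2 /
          ‖blaschkeFactor a p + blaschkeFactor a z‖ ^ 2) := by
        have := poissonKernel_pos hp hz
        gcongr
    _ = ‖deriv (blaschkeSq a) p‖ * poissonKernel 0 (blaschkeSq a z) p :=
        (norm_deriv_mul_poissonKernel_blaschkeSq ha hp hfix hz).symm
    _ ≤ poissonKernel 0 (blaschkeSq a z) p := mul_le_of_le_one_left hBz.le hp'

lemma tendsto_of_tendsto_poissonKernel_atTop {ι : Type*} {l : Filter ι} {u : ι → ℂ}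
    (hp : ‖p‖ = 1) (hu : Tendsto (fun i => poissonKernel 0 (u i) p) l atTop) :
    Tendsto u l (𝓝 p) := by
  refine tendsto_of_tendsto_norm_sub_sq
    (squeeze_zero' (.of_forall fun _ => by positivity) ?_ hu.inv_tendsto_atTop)
  filter_upwards [hu.eventually_gt_atTop 0] with i hi
  rw [poissonKernel_zero_of_norm_eq_one hp] at hi
  have hnum : 0 < 1 - ‖u i‖ ^ 2 := pos_of_mul_pos_left hi (by positivity)
  simp only [Pi.inv_apply]
  rw [poissonKernel_zero_of_norm_eq_one hp, inv_div, le_div_iff₀ hnum]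
  nlinarith [sq_nonneg ‖u i‖, sq_nonneg ‖p - u i‖]

lemma tendsto_iterate_of_norm_deriv_le_one (ha : ‖a‖ < 1) (hp : ‖p‖ = 1)
    (hfix : IsFixedPt (blaschkeSq a) p) (hp' : ‖deriv (blaschkeSq a) p‖ ≤ 1) (hz : ‖z‖ < 1) :
    Tendsto (fun n => (blaschkeSq a)^[n] z) atTop (𝓝 p) := by
  set u : ℕ → ℂ := fun n => (blaschkeSq a)^[n] z
  set P : ℕ → ℝ := fun n => poissonKernel 0 (u n) p with hP
  have hu1 (n : ℕ) : ‖u n‖ < 1 := mem_ball_zero_iff.1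
    ((mapsTo_blaschkeSq_ball ha).iterate n (mem_ball_zero_iff.2 hz))
  have hu_succ (n : ℕ) : u (n + 1) = blaschkeSq a (u n) := iterate_succ_apply' _ n z
  have hP_pos (n : ℕ) : 0 < P n := poissonKernel_pos hp (hu1 n)
  have hgrow (n : ℕ) :
      P n * (1 + ‖blaschkeFactor a p - blaschkeFactor a (u n)‖ ^ 2 / 4) ≤ P (n + 1) := by
    simpa only [hP, hu_succ] using
      poissonKernel_mul_le_poissonKernel_blaschkeSq ha hp hfix hp' (hu1 n)
  -- Either the increasing sequence `P n` blows up, or the factors `1 + ‖…‖ ^ 2 / 4` tend to `1`.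
  have hmono : Monotone P := monotone_nat_of_le_succ fun n =>
    (le_mul_of_one_le_right (hP_pos n).le (le_add_of_nonneg_right (by positivity))).trans (hgrow n)
  obtain htop | ⟨L, hL⟩ := tendsto_atTop_of_monotone hmono
  · exact tendsto_of_tendsto_poissonKernel_atTop hp htop
  have hdiff : Tendsto (fun n => 4 / P 0 * (P (n + 1) - P n)) atTop (𝓝 0) := by
    simpa using ((hL.comp (tendsto_add_atTop_nat 1)).sub hL).const_mul (4 / P 0)
  have hsq : Tendsto (fun n => ‖blaschkeFactor a p - blaschkeFactor a (u n)‖ ^ 2) atTop (𝓝 0) := by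
    refine squeeze_zero (fun _ => by positivity) (fun n => ?_) hdiff
    rw [div_mul_eq_mul_div, le_div_iff₀ (hP_pos 0)]
    nlinarith [hgrow n, hmono (Nat.zero_le n),
      sq_nonneg ‖blaschkeFactor a p - blaschkeFactor a (u n)‖]
  have hlim := (tendsto_of_tendsto_norm_sub_sq hsq).pow 2
  rw [← blaschkeSq_eq_sq, hfix.eq] at hlim
  exact (tendsto_add_atTop_iff_nat 1).1 (hlim.congr fun n => (hu_succ n).symm)

lemma iteratesTendstoOnDisk_of_isNonrepellingFixedPt (ha : ‖a‖ < 1) (hp : ‖p‖ = 1)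
    (hnon : IsNonrepellingFixedPt (blaschkeSq a) p) : IteratesTendstoOnDisk (blaschkeSq a) p :=
  iteratesTendstoOnDisk_of_tendsto (differentiableOn_blaschkeSq ha) (mapsTo_blaschkeSq_ball ha)
    fun _ hz => tendsto_iterate_of_norm_deriv_le_one ha hp hnon.2.1 hnon.2.2
      (mem_ball_zero_iff.1 hz)

lemma isNonrepellingFixedPt_sphere_iff_eq (ha : ‖a‖ < 1) (hp : ‖p‖ = 1)
    (hpnon : IsNonrepellingFixedPt (blaschkeSq a) p) (hq : ‖q‖ = 1) :
    IsNonrepellingFixedPt (blaschkeSq a) q ↔ q = p :=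
  ⟨fun hqnon => tendsto_nhds_unique
    (tendsto_iterate_of_norm_deriv_le_one ha hq hqnon.2.1 hqnon.2.2 (z := 0) (by simp))
    (tendsto_iterate_of_norm_deriv_le_one ha hp hpnon.2.1 hpnon.2.2 (by simp)),
    fun h => h ▸ hpnon⟩

end Julia

/-- The cubic whose roots in the closed disk are the fixed points of `blaschkeSq a`: it is
`z (1 + ā z) ^ 2 - (z + a) ^ 2`. -/
noncomputable def fixedPtCubic (a : ℂ) : Cubic ℂ :=
  ⟨conj a ^ 2, 2 * conj a - 1, 1 - 2 * a, -a ^ 2⟩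

section FixedPtCubic

variable {a z : ℂ}

lemma eval_fixedPtCubic (a z : ℂ) :
    (fixedPtCubic a).toPoly.eval z = z * (1 + conj a * z) ^ 2 - (z + a) ^ 2 := by
  simp only [Cubic.toPoly, fixedPtCubic, Polynomial.eval_add, Polynomial.eval_mul,
    Polynomial.eval_pow, Polynomial.eval_C, Polynomial.eval_X]
  ring

lemma blaschkeSq_sub_self (hz : 1 + conj a * z ≠ 0) :
    blaschkeSq a z - z = -(fixedPtCubic a).toPoly.eval z / (1 + conj a * z) ^ 2 := by
  rw [eval_fixedPtCubic, blaschkeSq, div_pow, div_sub' (pow_ne_zero 2 hz)]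
  ring

lemma isFixedPt_blaschkeSq_iff (hz : 1 + conj a * z ≠ 0) :
    IsFixedPt (blaschkeSq a) z ↔ (fixedPtCubic a).toPoly.IsRoot z := by
  rw [IsFixedPt, ← sub_eq_zero, blaschkeSq_sub_self hz, div_eq_zero_iff,
    or_iff_left (pow_ne_zero 2 hz), neg_eq_zero, Polynomial.IsRoot]

lemma eval_derivative_fixedPtCubic (hz : 1 + conj a * z ≠ 0)
    (hroot : (fixedPtCubic a).toPoly.IsRoot z) :
    (fixedPtCubic a).toPoly.derivative.eval z =
      (1 - deriv (blaschkeSq a) z) * (1 + conj a * z) ^ 2 := by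
  have hsub : (fun w => blaschkeSq a w - w) =ᶠ[𝓝 z]
      fun w => -(fixedPtCubic a).toPoly.eval w / (1 + conj a * w) ^ 2 := by
    have hcont : ContinuousAt (fun w : ℂ => 1 + conj a * w) z := by fun_prop
    filter_upwards [hcont.eventually_ne hz] with w hw using blaschkeSq_sub_self hw
  have hquot := ((fixedPtCubic a).toPoly.hasDerivAt z).neg.div
    (DifferentiableAt.hasDerivAt (f := fun w => (1 + conj a * w) ^ 2) (by fun_prop))
    (pow_ne_zero 2 hz)
  have hleft := (hasDerivAt_blaschkeSq hz).differentiableAt.hasDerivAt.sub (hasDerivAt_id z)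
  have heq := (hleft.congr_of_eventuallyEq hsub.symm).unique hquot
  simp only [Pi.neg_apply, hroot.eq_zero, neg_zero, zero_mul, sub_zero] at heq
  field_simp at heq
  linear_combination heq

lemma isRoot_fixedPtCubic_inv_conj (hz : z ≠ 0) (hroot : (fixedPtCubic a).toPoly.IsRoot z) :
    (fixedPtCubic a).toPoly.IsRoot (conj z)⁻¹ := by
  have hconj := congrArg conj hroot.eq_zero
  have hz' : conj z ≠ 0 := (map_ne_zero _).2 hz
  rw [Polynomial.IsRoot, eval_fixedPtCubic]
  simp only [eval_fixedPtCubic, map_add, map_mul, map_sub, map_pow, conj_conj, map_one,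
    map_zero] at hconj
  field_simp
  linear_combination -hconj

lemma norm_eq_one_of_isRoot_fixedPtCubic (ha : ‖a‖ < 1)
    (hno : ∀ z ∈ ball (0 : ℂ) 1, ¬IsFixedPt (blaschkeSq a) z)
    (hroot : (fixedPtCubic a).toPoly.IsRoot z) : ‖z‖ = 1 := by
  have hge {w : ℂ} (hw : (fixedPtCubic a).toPoly.IsRoot w) : 1 ≤ ‖w‖ := by
    by_contra! hlt
    exact hno w (mem_ball_zero_iff.2 hlt)
      ((isFixedPt_blaschkeSq_iff (one_add_conj_mul_ne_zero ha hlt.le)).2 hw)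
  have hz : z ≠ 0 := norm_pos_iff.1 (zero_lt_one.trans_le (hge hroot))
  have hinv := hge (isRoot_fixedPtCubic_inv_conj hz hroot)
  rw [norm_inv, RCLike.norm_conj, one_le_inv₀ (norm_pos_iff.2 hz)] at hinv
  exact hinv.antisymm (hge hroot)

lemma discr_fixedPtCubic (a : ℂ) :
    (fixedPtCubic a).discr = ((1 - ‖a‖ ^ 2) ^ 2 * (1 - cardioidValue a) : ℝ) := by
  have hnorm : (‖a‖ : ℂ) ^ 2 = conj a * a := (conj_mul' a).symm
  have hre : (a.re : ℂ) = (a + conj a) / 2 := re_eq_add_conj a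
  simp only [Cubic.discr, fixedPtCubic, cardioidValue]
  push_cast
  rw [show (‖a‖ : ℂ) ^ 4 = (‖a‖ ^ 2) ^ 2 by ring, hnorm, hre]
  ring

end FixedPtCubic

section InteriorFixedPoint

variable {a v z : ℂ}

/-- The equation `v (1 + ā v ^ 2) = v ^ 2 + a` and its conjugate form a linear system for `a` and
`ā`. -/
lemma mul_eq_of_blaschkeFactor_sq (ha : ‖a‖ < 1) (hv : ‖v‖ < 1)
    (hfix : blaschkeFactor a (v ^ 2) = v) :
    a * (1 + v * conj v + (v * conj v) ^ 2) = v * (1 + v * conj v - v) := by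
  have hd := one_add_conj_mul_ne_zero ha
    ((norm_pow v 2).trans_le (pow_le_one₀ (norm_nonneg v) hv.le))
  rw [blaschkeFactor, div_eq_iff hd] at hfix
  have hconj := congrArg conj hfix
  simp only [map_add, map_mul, map_pow, conj_conj, map_one] at hconj
  have hne : 1 - v * conj v ≠ 0 := by
    rw [mul_conj', ← ofReal_pow, ← ofReal_one, ← ofReal_sub, ofReal_ne_zero]
    exact (one_sub_norm_sq_pos hv).ne'
  refine mul_left_cancel₀ hne ?_
  linear_combination hfix + v ^ 3 * hconj

lemma eval_fixedPtCubic_of_interior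
    (hav : a * (1 + v * conj v + (v * conj v) ^ 2) = v * (1 + v * conj v - v)) (z : ℂ) :
    (1 + v * conj v + (v * conj v) ^ 2) ^ 2 * (fixedPtCubic a).toPoly.eval z =
      (z - v ^ 2) * (1 - conj v ^ 2 * z) *
        ((1 + v * conj v - v) ^ 2 - conj (1 + v * conj v - v) ^ 2 * z) := by
  have hconj := congrArg conj hav
  simp only [map_add, map_sub, map_mul, map_pow, conj_conj, map_one] at hconj ⊢
  rw [eval_fixedPtCubic]
  linear_combination
    z ^ 2 * (2 * (1 + v * conj v + (v * conj v) ^ 2) +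
      conj a * (1 + v * conj v + (v * conj v) ^ 2) * z +
      conj v * (1 + v * conj v - conj v) * z) * hconj -
    (2 * (1 + v * conj v + (v * conj v) ^ 2) * z + a * (1 + v * conj v + (v * conj v) ^ 2) +
      v * (1 + v * conj v - v)) * hav

lemma one_sub_cardioidValue_of_interior
    (hav : a * (1 + v * conj v + (v * conj v) ^ 2) = v * (1 + v * conj v - v)) :
    (1 + ‖v‖ ^ 2 + ‖v‖ ^ 4) ^ 4 * (1 - cardioidValue a) =
      (1 - ‖v‖ ^ 2) ^ 2 * ‖(1 + 2 * ‖v‖ ^ 2) - (2 + ‖v‖ ^ 2) * v‖ ^ 4 := by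
  have hconj := congrArg conj hav
  simp only [map_add, map_sub, map_mul, map_pow, conj_conj, map_one] at hconj
  have hmul : a * conj a * (1 + v * conj v + (v * conj v) ^ 2) ^ 2 =
      v * conj v * (1 + v * conj v - v) * (1 + v * conj v - conj v) := by
    linear_combination conj a * (1 + v * conj v + (v * conj v) ^ 2) * hav +
      v * (1 + v * conj v - v) * hconj
  have hpow (x : ℂ) : (‖x‖ : ℂ) ^ 4 = (x * conj x) ^ 2 := by rw [mul_conj']; ring
  rw [← ofReal_inj, cardioidValue]
  push_cast
  simp only [hpow, ← mul_conj', re_eq_add_conj, map_sub, map_add, map_mul, conj_conj, map_one,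
    map_ofNat]
  linear_combination
    (18 * (1 + v * conj v + (v * conj v) ^ 2) ^ 2 -
      27 * (a * conj a * (1 + v * conj v + (v * conj v) ^ 2) ^ 2 +
        v * conj v * (1 + v * conj v - v) * (1 + v * conj v - conj v))) * hmul -
    4 * (1 + v * conj v + (v * conj v) ^ 2) ^ 3 * (hav + hconj)

lemma cardioidValue_lt_one_of_isFixedPt_ball (ha : ‖a‖ < 1) (hz : ‖z‖ < 1)
    (hfix : IsFixedPt (blaschkeSq a) z) : cardioidValue a < 1 := by
  set v := blaschkeFactor a z
  have hv1 : ‖v‖ < 1 := norm_blaschkeFactor_lt_one ha hz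
  have hvz : v ^ 2 = z := hfix
  have hQ := one_sub_cardioidValue_of_interior
    (mul_eq_of_blaschkeFactor_sq ha hv1 (by rw [hvz]))
  have hne : (1 + 2 * ‖v‖ ^ 2 : ℂ) - (2 + ‖v‖ ^ 2) * v ≠ 0 := by
    intro h
    have hnorm := congrArg norm (sub_eq_zero.1 h)
    rw [norm_mul] at hnorm
    norm_cast at hnorm
    rw [Real.norm_of_nonneg (by positivity), Real.norm_of_nonneg (by positivity)] at hnorm
    nlinarith [norm_nonneg v, mul_pos (sub_pos.2 hv1) (by nlinarith : 0 < 1 - ‖v‖ + ‖v‖ ^ 2)]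
  have hpos : 0 < (1 - ‖v‖ ^ 2) ^ 2 * ‖(1 + 2 * ‖v‖ ^ 2 : ℂ) - (2 + ‖v‖ ^ 2) * v‖ ^ 4 :=
    mul_pos (pow_pos (one_sub_norm_sq_pos hv1) 2) (pow_pos (norm_pos_iff.2 hne) 4)
  rw [← hQ] at hpos
  exact sub_pos.1 (pos_of_mul_pos_right hpos (by positivity))

lemma exists_isFixedPt_sphere_iff_eq (ha : ‖a‖ < 1) (hz : ‖z‖ < 1)
    (hfix : IsFixedPt (blaschkeSq a) z) :
    ∃ β : ℂ, ‖β‖ = 1 ∧ ∀ w : ℂ, ‖w‖ = 1 → (IsFixedPt (blaschkeSq a) w ↔ w = β) := by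
  set v := blaschkeFactor a z
  have hv1 : ‖v‖ < 1 := norm_blaschkeFactor_lt_one ha hz
  have hvz : v ^ 2 = z := hfix
  have hav := mul_eq_of_blaschkeFactor_sq ha hv1 (by rw [hvz])
  set g := 1 + v * conj v - v
  have hg0 : g ≠ 0 := by
    intro h0
    have hnorm := congrArg norm (sub_eq_zero.1 h0)
    rw [mul_conj'] at hnorm
    norm_cast at hnorm
    rw [Real.norm_of_nonneg (by positivity)] at hnorm
    nlinarith [sq_nonneg ‖v‖]
  have hT : 1 + v * conj v + (v * conj v) ^ 2 ≠ 0 := by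
    rw [mul_conj']
    norm_cast
    positivity
  have hg0' : conj g ^ 2 ≠ 0 := pow_ne_zero 2 ((map_ne_zero _).2 hg0)
  refine ⟨g ^ 2 / conj g ^ 2, ?_, fun w hw => ?_⟩
  · rw [norm_div, norm_pow, norm_pow, RCLike.norm_conj,
      div_self (pow_ne_zero 2 (norm_ne_zero_iff.2 hg0))]
  have hwz : w - v ^ 2 ≠ 0 := by
    rw [hvz]
    exact norm_pos_iff.1 (norm_sub_pos_of_norm_lt_one hw hz)
  have hwz' : 1 - conj v ^ 2 * w ≠ 0 := by
    refine norm_pos_iff.1 (norm_sub_pos_of_norm_lt_one norm_one ?_)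
    rwa [norm_mul, hw, mul_one, ← map_pow, RCLike.norm_conj, hvz]
  rw [isFixedPt_blaschkeSq_iff (one_add_conj_mul_ne_zero ha hw.le), Polynomial.IsRoot,
    ← mul_eq_zero_iff_left (pow_ne_zero 2 hT), eval_fixedPtCubic_of_interior hav w,
    mul_eq_zero_iff_left (mul_ne_zero hwz hwz'), sub_eq_zero, eq_div_iff hg0', eq_comm, mul_comm]

end InteriorFixedPoint

section Multiplicity

open Polynomial

lemma analyticOrderNatAt_eval {𝕜 : Type*} [NontriviallyNormedField 𝕜] {P : 𝕜[X]} (hP : P ≠ 0)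
    (z : 𝕜) : analyticOrderNatAt (fun w => P.eval w) z = P.rootMultiplicity z := by
  obtain ⟨R, hPR, hR⟩ := P.exists_eq_pow_rootMultiplicity_mul_and_not_dvd hP z
  have hanalytic (T : 𝕜[X]) : AnalyticAt 𝕜 (fun w => T.eval w) z :=
    AnalyticOnNhd.eval_polynomial T z (Set.mem_univ z)
  have horder : analyticOrderAt (fun w => P.eval w) z = P.rootMultiplicity z := by
    refine (hanalytic P).analyticOrderAt_eq_natCast.2
      ⟨fun w => R.eval w, hanalytic R, ?_, .of_forall fun w => ?_⟩
    · rwa [dvd_iff_isRoot] at hR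
    · conv_lhs => rw [hPR]
      simp only [eval_mul, eval_pow, eval_sub, eval_X, eval_C, smul_eq_mul]
  rw [analyticOrderNatAt, horder, ENat.toNat_natCast]

lemma finsum_mem_rootMultiplicity {R : Type*} [CommRing R] [IsDomain R] {P : R[X]} {S : Set R}
    (hS : ∀ z ∈ P.roots, z ∈ S) : ∑ᶠ z ∈ S, P.rootMultiplicity z = P.roots.card := by
  classical
  rw [finsum_mem_eq_sum_of_inter_support_eq (t := P.roots.toFinset),
    ← P.roots.toFinset_sum_count_eq]
  · simp only [count_roots]
  · ext z
    simp only [Set.mem_inter_iff, Finset.mem_coe, Multiset.mem_toFinset, mem_support,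
      ← count_roots, Multiset.count_ne_zero]
    exact ⟨fun h => ⟨h.2, h.2⟩, fun h => ⟨hS z h.1, h.2⟩⟩

end Multiplicity

section BoundaryFixedPoints

variable {a x y z : ℂ}

lemma ne_zero_of_forall_not_isFixedPt (hno : ∀ z ∈ ball (0 : ℂ) 1, ¬IsFixedPt (blaschkeSq a) z) :
    a ≠ 0 := by
  rintro rfl
  exact hno 0 (by simp) (by simp [IsFixedPt, blaschkeSq])

lemma fixedPtCubic_a_ne_zero (ha0 : a ≠ 0) : (fixedPtCubic a).a ≠ 0 :=
  pow_ne_zero 2 ((map_ne_zero _).2 ha0)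

lemma fixedPtMultiplicity_blaschkeSq (ha0 : a ≠ 0) (hz : 1 + conj a * z ≠ 0) :
    fixedPtMultiplicity (blaschkeSq a) z = (fixedPtCubic a).toPoly.rootMultiplicity z := by
  have hsub : (fun w => blaschkeSq a w - w) =ᶠ[𝓝 z]
      (fun w => -1 / (1 + conj a * w) ^ 2) * fun w => (fixedPtCubic a).toPoly.eval w := by
    have hcont : ContinuousAt (fun w : ℂ => 1 + conj a * w) z := by fun_prop
    filter_upwards [hcont.eventually_ne hz] with w hw
    rw [blaschkeSq_sub_self hw, Pi.mul_apply]
    ring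
  have hunit : AnalyticAt ℂ (fun w => -1 / (1 + conj a * w) ^ 2) z :=
    AnalyticAt.div (by fun_prop) (by fun_prop) (pow_ne_zero 2 hz)
  have hP := Cubic.ne_zero_of_a_ne_zero (fixedPtCubic_a_ne_zero ha0)
  rw [fixedPtMultiplicity, ← analyticOrderNatAt_eval hP, analyticOrderNatAt, analyticOrderNatAt,
    analyticOrderAt_congr hsub, analyticOrderAt_mul hunit
    (AnalyticOnNhd.eval_polynomial (fixedPtCubic a).toPoly z (Set.mem_univ z)),
    hunit.analyticOrderAt_eq_zero.2 (div_ne_zero (by simp) (pow_ne_zero 2 hz)), zero_add]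

lemma card_roots_fixedPtCubic (ha0 : a ≠ 0) : (fixedPtCubic a).roots.card = 3 :=
  (Cubic.splits_iff_card_roots (φ := RingHom.id ℂ) (fixedPtCubic_a_ne_zero ha0)).1
    (IsAlgClosed.splits _)

lemma exists_roots_fixedPtCubic (ha0 : a ≠ 0) :
    ∃ x y z : ℂ, (fixedPtCubic a).roots = {x, y, z} :=
  Multiset.card_eq_three.1 (card_roots_fixedPtCubic ha0)

lemma mem_roots_fixedPtCubic_iff (ha : ‖a‖ < 1)
    (hno : ∀ z ∈ ball (0 : ℂ) 1, ¬IsFixedPt (blaschkeSq a) z) :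
    z ∈ (fixedPtCubic a).roots ↔ ‖z‖ = 1 ∧ IsFixedPt (blaschkeSq a) z := by
  have hP := Cubic.ne_zero_of_a_ne_zero
    (fixedPtCubic_a_ne_zero (ne_zero_of_forall_not_isFixedPt hno))
  rw [Cubic.roots, Polynomial.mem_roots hP]
  refine ⟨fun h => ?_, fun ⟨hz, hfix⟩ =>
    (isFixedPt_blaschkeSq_iff (one_add_conj_mul_ne_zero ha hz.le)).1 hfix⟩
  have hz := norm_eq_one_of_isRoot_fixedPtCubic ha hno h
  exact ⟨hz, (isFixedPt_blaschkeSq_iff (one_add_conj_mul_ne_zero ha hz.le)).2 h⟩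

lemma finsum_fixedPtMultiplicity_blaschkeSq (ha : ‖a‖ < 1)
    (hno : ∀ z ∈ ball (0 : ℂ) 1, ¬IsFixedPt (blaschkeSq a) z) :
    ∑ᶠ z ∈ sphere (0 : ℂ) 1, fixedPtMultiplicity (blaschkeSq a) z = 3 := by
  have ha0 := ne_zero_of_forall_not_isFixedPt hno
  rw [finsum_mem_congr rfl fun z hz => fixedPtMultiplicity_blaschkeSq ha0
    (one_add_conj_mul_ne_zero ha (mem_sphere_zero_iff_norm.1 hz).le),
    finsum_mem_rootMultiplicity fun z hz =>
      mem_sphere_zero_iff_norm.2 ((mem_roots_fixedPtCubic_iff ha hno).1 hz).1]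
  exact card_roots_fixedPtCubic ha0

lemma sq_sub_of_norm_eq_one (hx : ‖x‖ = 1) (hy : ‖y‖ = 1) :
    (x - y) ^ 2 = -(x * y) * ‖x - y‖ ^ 2 := by
  have hx' : x * conj x = 1 := by rw [mul_conj', hx]; norm_num
  have hy' : y * conj y = 1 := by rw [mul_conj', hy]; norm_num
  rw [← mul_conj', map_sub]
  linear_combination (x * y - y ^ 2) * hx' + (x * y - x ^ 2) * hy'

lemma sq_mul_cardioidValue_sub_one (ha0 : a ≠ 0) (hroots : (fixedPtCubic a).roots = {x, y, z})
    (hx : ‖x‖ = 1) (hy : ‖y‖ = 1) (hz : ‖z‖ = 1) :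
    (1 - ‖a‖ ^ 2) ^ 2 * (cardioidValue a - 1) =
      ‖a‖ ^ 8 * (‖x - y‖ * ‖x - z‖ * ‖y - z‖) ^ 2 := by
  have hA := fixedPtCubic_a_ne_zero ha0
  have hdiscr := Cubic.discr_eq_prod_three_roots (φ := RingHom.id ℂ) hA hroots
  have hprod := Cubic.d_eq_three_roots (φ := RingHom.id ℂ) hA hroots
  simp only [RingHom.id_apply] at hdiscr hprod
  rw [discr_fixedPtCubic] at hdiscr
  simp only [fixedPtCubic] at hdiscr hprod
  have hsq : ((x - y) * (x - z) * (y - z)) ^ 2 =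
      -(x * y * z) ^ 2 * (‖x - y‖ * ‖x - z‖ * ‖y - z‖) ^ 2 := by
    rw [mul_pow, mul_pow, sq_sub_of_norm_eq_one hx hy, sq_sub_of_norm_eq_one hx hz,
      sq_sub_of_norm_eq_one hy hz]
    ring
  have hnorm : (‖a‖ : ℂ) ^ 8 = (conj a * a) ^ 4 := by rw [conj_mul']; ring
  rw [← ofReal_inj]
  push_cast at hdiscr ⊢
  rw [hnorm]
  linear_combination -hdiscr - conj a ^ 8 * hsq +
    conj a ^ 4 * (conj a ^ 2 * (x * y * z) + a ^ 2) *
      (‖x - y‖ * ‖x - z‖ * ‖y - z‖) ^ 2 * hprod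

lemma one_le_cardioidValue (ha : ‖a‖ < 1)
    (hno : ∀ z ∈ ball (0 : ℂ) 1, ¬IsFixedPt (blaschkeSq a) z) : 1 ≤ cardioidValue a := by
  have ha0 := ne_zero_of_forall_not_isFixedPt hno
  obtain ⟨x, y, z, hroots⟩ := exists_roots_fixedPtCubic ha0
  have hnorm (w : ℂ) (hw : w ∈ ({x, y, z} : Multiset ℂ)) : ‖w‖ = 1 :=
    ((mem_roots_fixedPtCubic_iff ha hno).1 (hroots ▸ hw)).1
  have h := sq_mul_cardioidValue_sub_one ha0 hroots (hnorm x (by simp)) (hnorm y (by simp))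
    (hnorm z (by simp))
  have hpos := pow_pos (one_sub_norm_sq_pos ha) 2
  exact sub_nonneg.1 (nonneg_of_mul_nonneg_right (h ▸ by positivity) hpos)

lemma nodup_roots_fixedPtCubic_iff (ha : ‖a‖ < 1) (ha0 : a ≠ 0) :
    (fixedPtCubic a).roots.Nodup ↔ cardioidValue a ≠ 1 := by
  have hdiscr := Cubic.discr_ne_zero_iff_roots_nodup (φ := RingHom.id ℂ)
    (fixedPtCubic_a_ne_zero ha0) (IsAlgClosed.splits _)
  rw [discr_fixedPtCubic, ofReal_ne_zero,
    mul_ne_zero_iff_left (pow_ne_zero 2 (one_sub_norm_sq_pos ha).ne'), sub_ne_zero] at hdiscr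
  exact hdiscr.symm.trans ne_comm

lemma exists_isFixedPt_ball (ha : ‖a‖ < 1) (hQ : cardioidValue a < 1) :
    ∃ z : ℂ, ‖z‖ < 1 ∧ IsFixedPt (blaschkeSq a) z := by
  by_contra! hno
  exact (one_le_cardioidValue ha fun z hz => hno z (mem_ball_zero_iff.1 hz)).not_gt hQ

lemma ncard_isFixedPt_sphere (ha : ‖a‖ < 1)
    (hno : ∀ z ∈ ball (0 : ℂ) 1, ¬IsFixedPt (blaschkeSq a) z) (hQ : 1 < cardioidValue a) :
    {z ∈ sphere (0 : ℂ) 1 | IsFixedPt (blaschkeSq a) z}.ncard = 3 := by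
  have ha0 := ne_zero_of_forall_not_isFixedPt hno
  have hset : {z ∈ sphere (0 : ℂ) 1 | IsFixedPt (blaschkeSq a) z} =
      (fixedPtCubic a).roots.toFinset := by
    ext z
    simp only [Finset.mem_coe, Multiset.mem_toFinset, mem_roots_fixedPtCubic_iff ha hno,
      mem_sphere_zero_iff_norm, Set.mem_ofPred_eq]
  rw [hset, Set.ncard_coe_finset, Multiset.toFinset_card_of_nodup
    ((nodup_roots_fixedPtCubic_iff ha ha0).2 hQ.ne'), card_roots_fixedPtCubic ha0]

end BoundaryFixedPoints

section Multipliers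

variable {a p x y z : ℂ}

lemma deriv_blaschkeSq_eq_norm (ha : ‖a‖ < 1) (hp : ‖p‖ = 1) (hfix : IsFixedPt (blaschkeSq a) p) :
    deriv (blaschkeSq a) p = ‖deriv (blaschkeSq a) p‖ := by
  have hd := one_add_conj_mul_ne_zero ha hp.le
  have hd' : conj (1 + conj a * p) ≠ 0 := (map_ne_zero _).2 hd
  have hq := norm_blaschkeFactor_eq_one ha hp
  have hq0 : blaschkeFactor a p ≠ 0 := norm_ne_zero_iff.1 (hq.trans_ne one_ne_zero)
  have hqd : blaschkeFactor a p * (1 + conj a * p) = p + a := div_mul_cancel₀ _ hd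
  have hqp : blaschkeFactor a p ^ 2 = p := hfix
  have hpp : p * conj p = 1 := by rw [mul_conj', hp, ofReal_one, one_pow]
  have hphase : blaschkeFactor a p * conj (1 + conj a * p) = 1 + conj a * p := by
    refine mul_left_cancel₀ hq0 ?_
    simp only [map_add, map_mul, conj_conj, map_one]
    linear_combination (1 + a * conj p) * hqp - hqd + a * hpp
  rw [norm_deriv_blaschkeSq ha hp.le, hq, (hasDerivAt_blaschkeSq hd).deriv, mul_one]
  push_cast
  rw [← mul_conj' (1 + conj a * p), div_eq_div_iff (pow_ne_zero 2 hd) (mul_ne_zero hd hd')]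
  linear_combination 2 * (1 - (‖a‖ : ℂ) ^ 2) * (1 + conj a * p) * hphase

lemma eval_derivative_toPoly_of_roots_eq {F : Type*} [Field F] {P : Cubic F} {x y z : F}
    (ha : P.a ≠ 0) (hroots : P.roots = {x, y, z}) :
    P.toPoly.derivative.eval x = P.a * (x - y) * (x - z) := by
  have hprod : P.toPoly = _ := Cubic.eq_prod_three_roots (φ := RingHom.id F) ha hroots
  rw [hprod]
  simp only [RingHom.id_apply, Polynomial.derivative_mul, Polynomial.derivative_C,
    Polynomial.derivative_X_sub_C, Polynomial.eval_add, Polynomial.eval_mul, Polynomial.eval_sub,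
    Polynomial.eval_C, Polynomial.eval_X, Polynomial.eval_zero, Polynomial.eval_one]
  ring

lemma inv_one_sub_deriv_blaschkeSq (ha0 : a ≠ 0) (hx : 1 + conj a * x ≠ 0)
    (hroots : (fixedPtCubic a).roots = {x, y, z}) :
    (1 - deriv (blaschkeSq a) x)⁻¹ = (1 + conj a * x) ^ 2 / (conj a ^ 2 * (x - y) * (x - z)) := by
  have hroot : (fixedPtCubic a).toPoly.IsRoot x :=
    Polynomial.isRoot_of_mem_roots (by rw [← Cubic.roots, hroots]; simp)
  have hA : (fixedPtCubic a).a = conj a ^ 2 := rfl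
  rw [← hA, ← eval_derivative_toPoly_of_roots_eq (fixedPtCubic_a_ne_zero ha0) hroots,
    eval_derivative_fixedPtCubic hx hroot, div_mul_cancel_right₀ (pow_ne_zero 2 hx)]

lemma sum_inv_one_sub_deriv_blaschkeSq (ha0 : a ≠ 0)
    (hroots : (fixedPtCubic a).roots = {x, y, z}) (hnodup : (fixedPtCubic a).roots.Nodup)
    (hd : ∀ w ∈ (fixedPtCubic a).roots, 1 + conj a * w ≠ 0) :
    (1 - deriv (blaschkeSq a) x)⁻¹ + (1 - deriv (blaschkeSq a) y)⁻¹ +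
      (1 - deriv (blaschkeSq a) z)⁻¹ = 1 := by
  have hyroots : (fixedPtCubic a).roots = {y, x, z} := hroots.trans (Multiset.cons_swap x y {z})
  have hzroots : (fixedPtCubic a).roots = {z, x, y} := by
    rw [hroots]
    exact (congrArg (x ::ₘ ·) (Multiset.pair_comm y z)).trans (Multiset.cons_swap x z {y})
  rw [inv_one_sub_deriv_blaschkeSq ha0 (hd x (by simp [hroots])) hroots,
    inv_one_sub_deriv_blaschkeSq ha0 (hd y (by simp [hroots])) hyroots,
    inv_one_sub_deriv_blaschkeSq ha0 (hd z (by simp [hroots])) hzroots]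
  obtain ⟨⟨hxy, hxz⟩, hyz⟩ : (x ≠ y ∧ x ≠ z) ∧ y ≠ z := by simpa [hroots] using hnodup
  have ha0' : conj a ≠ 0 := (map_ne_zero _).2 ha0
  have := sub_ne_zero.2 hxy
  have := sub_ne_zero.2 hxz
  have := sub_ne_zero.2 hyz
  rw [← neg_sub x y, ← neg_sub x z, ← neg_sub y z]
  field_simp
  ring

lemma exists_isAttractingFixedPt_sphere (ha : ‖a‖ < 1)
    (hno : ∀ z ∈ ball (0 : ℂ) 1, ¬IsFixedPt (blaschkeSq a) z) (hQ : cardioidValue a ≠ 1) :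
    ∃ p : ℂ, ‖p‖ = 1 ∧ IsAttractingFixedPt (blaschkeSq a) p := by
  by_contra! hrep
  have ha0 := ne_zero_of_forall_not_isFixedPt hno
  obtain ⟨x, y, z, hroots⟩ := exists_roots_fixedPtCubic ha0
  have hd (w : ℂ) (hw : w ∈ (fixedPtCubic a).roots) : 1 + conj a * w ≠ 0 :=
    one_add_conj_mul_ne_zero ha ((mem_roots_fixedPtCubic_iff ha hno).1 hw).1.le
  have hnonpos (w : ℂ) (hw : w ∈ (fixedPtCubic a).roots) :
      ((1 - deriv (blaschkeSq a) w)⁻¹).re ≤ 0 := by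
    obtain ⟨hw1, hfix⟩ := (mem_roots_fixedPtCubic_iff ha hno).1 hw
    have hone : 1 ≤ ‖deriv (blaschkeSq a) w‖ := by
      by_contra! hlt
      exact hrep w hw1 ⟨(hasDerivAt_blaschkeSq (hd w hw)).differentiableAt, hfix, hlt⟩
    rw [deriv_blaschkeSq_eq_norm ha hw1 hfix, ← ofReal_one, ← ofReal_sub, ← ofReal_inv, ofReal_re]
    exact inv_nonpos.2 (sub_nonpos.2 hone)
  have hsum := congrArg re (sum_inv_one_sub_deriv_blaschkeSq ha0 hroots
    ((nodup_roots_fixedPtCubic_iff ha ha0).2 hQ) hd)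
  rw [add_re, add_re, one_re] at hsum
  linarith [hnonpos x (by simp [hroots]), hnonpos y (by simp [hroots]),
    hnonpos z (by simp [hroots])]

lemma exists_deriv_blaschkeSq_eq_one (ha : ‖a‖ < 1)
    (hno : ∀ z ∈ ball (0 : ℂ) 1, ¬IsFixedPt (blaschkeSq a) z) (hQ : cardioidValue a = 1) :
    ∃ p : ℂ, ‖p‖ = 1 ∧ IsFixedPt (blaschkeSq a) p ∧ deriv (blaschkeSq a) p = 1 := by
  have ha0 := ne_zero_of_forall_not_isFixedPt hno
  have hdup : ¬(fixedPtCubic a).roots.Nodup :=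
    (nodup_roots_fixedPtCubic_iff ha ha0).not.2 (by simpa)
  simp only [Multiset.nodup_iff_count_le_one, not_forall, not_le, Cubic.roots,
    Polynomial.count_roots] at hdup
  obtain ⟨p, hp⟩ := hdup
  obtain ⟨hroot, hderiv⟩ := (Polynomial.one_lt_rootMultiplicity_iff_isRoot
    (Cubic.ne_zero_of_a_ne_zero (fixedPtCubic_a_ne_zero ha0))).1 hp
  have hp1 := norm_eq_one_of_isRoot_fixedPtCubic ha hno hroot
  have hd := one_add_conj_mul_ne_zero ha hp1.le
  rw [Polynomial.IsRoot, eval_derivative_fixedPtCubic hd hroot,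
    mul_eq_zero_iff_right (pow_ne_zero 2 hd), sub_eq_zero] at hderiv
  exact ⟨p, hp1, (isFixedPt_blaschkeSq_iff hd).2 hroot, hderiv.symm⟩

lemma exists_isNonrepellingFixedPt_sphere (ha : ‖a‖ < 1)
    (hno : ∀ z ∈ ball (0 : ℂ) 1, ¬IsFixedPt (blaschkeSq a) z) :
    ∃ p : ℂ, ‖p‖ = 1 ∧ IsNonrepellingFixedPt (blaschkeSq a) p ∧
      (IsAttractingFixedPt (blaschkeSq a) p ↔ 1 < cardioidValue a) := by
  obtain hQ | hQ := (one_le_cardioidValue ha hno).lt_or_eq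
  · obtain ⟨p, hp, hatt⟩ := exists_isAttractingFixedPt_sphere ha hno hQ.ne'
    exact ⟨p, hp, ⟨hatt.1, hatt.2.1, hatt.2.2.le⟩, fun _ => hQ, fun _ => hatt⟩
  · obtain ⟨p, hp, hfix, hderiv⟩ := exists_deriv_blaschkeSq_eq_one ha hno hQ.symm
    have hdiff := (hasDerivAt_blaschkeSq (one_add_conj_mul_ne_zero ha hp.le)).differentiableAt
    have hnorm : ‖deriv (blaschkeSq a) p‖ = 1 := by rw [hderiv, norm_one]
    exact ⟨p, hp, ⟨hdiff, hfix, hnorm.le⟩, fun h => absurd hnorm h.2.2.ne, fun h => absurd hQ h.ne⟩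

end Multipliers

theorem mainTheorem5 (a : ℂ) (ha : ‖a‖ < 1) :
    (cardioidValue a < 1 →
      ∃ α ∈ ball (0 : ℂ) 1, ∃ β ∈ sphere (0 : ℂ) 1,
        (∀ z ∈ ball (0 : ℂ) 1, IsFixedPt (blaschkeSq a) z ↔ z = α) ∧
        (∀ z ∈ sphere (0 : ℂ) 1, IsFixedPt (blaschkeSq a) z ↔ z = β) ∧
        IsAttractingFixedPt (blaschkeSq a) α ∧
        ¬ IsAttractingFixedPt (blaschkeSq a) β ∧
        IteratesTendstoOnDisk (blaschkeSq a) α) ∧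
    (1 ≤ cardioidValue a →
      (∀ z ∈ ball (0 : ℂ) 1, ¬ IsFixedPt (blaschkeSq a) z) ∧
      (∑ᶠ z ∈ sphere (0 : ℂ) 1, fixedPtMultiplicity (blaschkeSq a) z) = 3 ∧
      (1 < cardioidValue a →
        {z ∈ sphere (0 : ℂ) 1 | IsFixedPt (blaschkeSq a) z}.ncard = 3) ∧
      ∃ p ∈ sphere (0 : ℂ) 1,
        (∀ z ∈ sphere (0 : ℂ) 1, IsNonrepellingFixedPt (blaschkeSq a) z ↔ z = p) ∧
        (IsAttractingFixedPt (blaschkeSq a) p ↔ 1 < cardioidValue a) ∧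
        IteratesTendstoOnDisk (blaschkeSq a) p) := by
  refine ⟨fun hQ => ?_, fun hQ => ?_⟩
  · obtain ⟨α, hα, hαfix⟩ := exists_isFixedPt_ball ha hQ
    obtain ⟨β, hβ, hβfix⟩ := exists_isFixedPt_sphere_iff_eq ha hα hαfix
    exact ⟨α, mem_ball_zero_iff.2 hα, β, mem_sphere_zero_iff_norm.2 hβ,
      fun z hz => isFixedPt_ball_iff_eq ha hα hαfix (mem_ball_zero_iff.1 hz),
      fun z hz => hβfix z (mem_sphere_zero_iff_norm.1 hz),
      isAttractingFixedPt_of_mem_ball ha hα hαfix,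
      fun hatt => (one_lt_norm_deriv_of_isFixedPt_ball ha hβ hatt.2.1 hα hαfix).not_gt hatt.2.2,
      iteratesTendstoOnDisk_of_isFixedPt_ball ha hα hαfix⟩
  · have hno : ∀ z ∈ ball (0 : ℂ) 1, ¬IsFixedPt (blaschkeSq a) z := fun z hz hfix =>
      (cardioidValue_lt_one_of_isFixedPt_ball ha (mem_ball_zero_iff.1 hz) hfix).not_ge hQ
    obtain ⟨p, hp, hnon, hatt⟩ := exists_isNonrepellingFixedPt_sphere ha hno
    exact ⟨hno, finsum_fixedPtMultiplicity_blaschkeSq ha hno, ncard_isFixedPt_sphere ha hno,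
      p, mem_sphere_zero_iff_norm.2 hp,
      fun z hz => isNonrepellingFixedPt_sphere_iff_eq ha hp hnon (mem_sphere_zero_iff_norm.1 hz),
      hatt, iteratesTendstoOnDisk_of_isNonrepellingFixedPt ha hp hnon⟩
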